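/- Let $\Omega\subset\mathbb{R}^d$ be a bounded convex set with at least two points (the decision set). For a sequence $f_1,\dots,f_T:\mathbb{R}^d\to\mathbb{R}$ of convex functions, each attaining its minimum over $\Omega$, let $\Omega_t^*$ be the set of minimizers of $f_t$ over $\Omega$ and define the path variation \[ V_T^p=\sup_{w_1^*\in\Omega_1^*,\dots,w_T^*\in\Omega_T^*}\ \sum_{t=1}^{T-1}\|w_t^*-w_{t+1}^*\|_2 . \] For $B_T>0$ let $\mathcal V_p$ be the set of all such sequences $(f_1,\dots,f_T)$ with $V_T^p\le B_T$. Policies and feedback. Let $U$ be a random variable with values in a measurable space $\mathbb U$. A policy $\pi$ consists of measurable maps $\pi_t:(\mathbb{R}^d)^{t-1}\times\mathbb U\to\Omega$, $t\ge1$, and plays $w_1=\pi_1(U)$ and $w_t=\pi_t(\phi_1,\dots,\phi_{t-1},U)$ for $t\ge2$. The feedback in round $t$ is a noisy subgradient $\phi_t=g_t+\epsilon_t$, where $g_t\in\partial f_t(w_t)$ (the subdifferential over $\mathbb{R}^d$) is obtained from $t$, $f_t$ and $w_t$ by an arbitrary selection that is measurable in $w_t$. Noise. The random vectors $\epsilon_1,\epsilon_2,\dots$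 in $\mathbb{R}^d$ are i.i.d. and independent of $U$, with mean zero and a covariance matrix $\Sigma$ satisfying $\operatorname{tr}\Sigma\le\lambda^2<\infty$, and their common law $P$ satisfies, for a constant $\tilde C>0$, \[ \mathrm{KL}\big(P\,\big\|\,P(\cdot+a)\big)=\int\log\frac{dP(y)}{dP(y+a)}\,dP(y)\le\tilde C\|a\|_2^2\qquad\text{for all }a\in\mathbb{R}^d . \] Regret. For a family $\mathcal V$ of sequences of $T$ loss functions put \[ \mathcal R_\phi^\pi(\mathcal V,T)=\sup_{(f_1,\dots,f_T)\in\mathcal V}\Big(\mathbb E\Big[\sum_{t=1}^Tf_t(w_t)\Big]-\sum_{t=1}^T\min_{w\in\Omega}f_t(w)\Big). \] Theorem (lower bound). For every $\kappa\in(1/2,1)$ there is a constant $C(\kappa)>0$, depending only on $\kappa$, $\tilde C$ and $\Omega$ (and not on $T$ or $B_T$), such that for every integer $T$ and real $B_T$ with $1\le B_T\le T$ there is a subfamily $\mathcal V_p'\subset\mathcal V_p$ such that every policy $\pi$, under every noisy subgradient feedback as above, satisfies \[ \mathcal R_\phi^\pi(\mathcal V_p',T)\ \ge\ C(\kappa)\,B_T^{\kappa}\,T^{1-\kappa}.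 \] Moreover, $\mathcal V_p'$ can be taken as follows: for two functions $f,g$, neither of which is strongly convex on $\Omega$, and some $\Delta\in\{1,\dots,T\}$, it consists of all sequences that, on each of the consecutive batches of $\Delta$ rounds into which $\{1,\dots,T\}$ is divided (the last one may be shorter), are constantly equal to $f$ or constantly equal to $g$. -/

import Mathlib

open MeasureTheory ProbabilityTheory InformationTheory
open scoped ENNReal

/-- The subdifferential of `f : ℝ^d → ℝ` at `x` (subgradient inequality over all of `ℝ^d`). -/
def subdifferential {d : ℕ} (f : EuclideanSpace ℝ (Fin d) → ℝ) (x : EuclideanSpace ℝ (Fin d)) :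
    Set (EuclideanSpace ℝ (Fin d)) :=
  {v | ∀ y, f x + inner ℝ v (y - x) ≤ f y}

/-- The set `Ω_t^*` of all minimizers of `f` over the decision set `Ω`. -/
def minimizers {d : ℕ} (Ω : Set (EuclideanSpace ℝ (Fin d))) (f : EuclideanSpace ℝ (Fin d) → ℝ) :
    Set (EuclideanSpace ℝ (Fin d)) :=
  {w | w ∈ Ω ∧ IsMinOn f Ω w}

/-- Path variation of `F_0, …, F_{T-1}` over `Ω`: the supremum, over all choices of minimizers
`w_t` of `F_t`, of the sum of the Euclidean distances of consecutive ones. (The values of `w`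
at times `≥ T` do not enter.) -/
noncomputable def pathVariation {d : ℕ} (Ω : Set (EuclideanSpace ℝ (Fin d))) {T : ℕ}
    (F : Fin T → EuclideanSpace ℝ (Fin d) → ℝ) : ℝ≥0∞ :=
  ⨆ (w : ℕ → EuclideanSpace ℝ (Fin d)) (_ : ∀ t : Fin T, w t ∈ minimizers Ω (F t)),
    ∑ t ∈ Finset.range (T - 1), edist (w t) (w (t + 1))

/-- The family of sequences of `T` convex loss functions that have minimizers in `Ω` and whose
path variation is at most `B`. -/
def pathVariationClass {d : ℕ} (Ω : Set (EuclideanSpace ℝ (Fin d))) (T : ℕ) (B : ℝ) :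
    Set (Fin T → EuclideanSpace ℝ (Fin d) → ℝ) :=
  {F | (∀ t, ConvexOn ℝ Set.univ (F t)) ∧ (∀ t, (minimizers Ω (F t)).Nonempty) ∧
    pathVariation Ω F ≤ ENNReal.ofReal B}

/-- The sequences of length `T` that use, on each batch `{jΔ, …, (j+1)Δ - 1}` of rounds, either
`f` throughout or `g` throughout. -/
def batchFamily {d : ℕ} (T Δ : ℕ) (f g : EuclideanSpace ℝ (Fin d) → ℝ) :
    Set (Fin T → EuclideanSpace ℝ (Fin d) → ℝ) :=
  {F | ∃ b : ℕ → Bool, ∀ t : Fin T, F t = if b ((t : ℕ) / Δ) then f else g}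

/-- `ε 0, ε 1, …` are i.i.d. random vectors, with mean zero, finite second moments, trace of
the covariance matrix at most `lam ^ 2`, and such that the Kullback-Leibler divergence of the law
`P(dy)` from its translate `P(dy + a)` (the law of `ε t - a`) is at most `K * ‖a‖ ^ 2`. -/
structure IsNoise {d : ℕ} {S : Type*} [MeasurableSpace S] (μ : Measure S)
    (ε : ℕ → S → EuclideanSpace ℝ (Fin d)) (lam K : ℝ) : Prop where
  measurable : ∀ t, Measurable (ε t)
  indep : iIndepFun ε μ
  identDistrib : ∀ t, IdentDistrib (ε t) (ε 0) μ μ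
  memLp : ∀ t, MemLp (ε t) 2 μ
  mean_zero : ∀ t, ∫ s, ε t s ∂μ = 0
  trace_cov_le : ∀ t, ∑ i, variance (fun s => ε t s i) μ ≤ lam ^ 2
  kl_le : ∀ t a, klDiv (μ.map (ε t)) (μ.map (fun s => ε t s - a)) ≤ ENNReal.ofReal (K * ‖a‖ ^ 2)

/-- A policy with decisions in `Ω` and internal randomness in `𝕌`: in round `t` (counted from `0`)
it maps the `t` feedback vectors received so far and the randomization to a decision. -/
structure Policy {d : ℕ} (Ω : Set (EuclideanSpace ℝ (Fin d))) (𝕌 : Type*)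
    [MeasurableSpace 𝕌] where
  act : (t : ℕ) → (Fin t → EuclideanSpace ℝ (Fin d)) → 𝕌 → EuclideanSpace ℝ (Fin d)
  measurable_act : ∀ t,
    Measurable (fun p : (Fin t → EuclideanSpace ℝ (Fin d)) × 𝕌 => act t p.1 p.2)
  act_mem : ∀ t h u, act t h u ∈ Ω

/-- `G t f w` is the (noiseless) subgradient of the convex function `f` at `w ∈ Ω` on which the
feedback of round `t` is based. -/
def IsSubgradientOracle {d : ℕ} (Ω : Set (EuclideanSpace ℝ (Fin d)))
    (G : ℕ → (EuclideanSpace ℝ (Fin d) → ℝ) → EuclideanSpace ℝ (Fin d) →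
      EuclideanSpace ℝ (Fin d)) : Prop :=
  ∀ t f, ConvexOn ℝ Set.univ f →
    Measurable (G t f) ∧ ∀ w ∈ Ω, G t f w ∈ subdifferential f w

/-- The feedback vectors of the first `t` rounds, `φ_τ = G τ (F τ) w_τ + e τ`, when the policy `π`
with randomization `u` faces the losses `F` and the noise realization `e`. -/
noncomputable def feedback {d : ℕ} {Ω : Set (EuclideanSpace ℝ (Fin d))} {𝕌 : Type*}
    [MeasurableSpace 𝕌] (π : Policy Ω 𝕌)
    (G : ℕ → (EuclideanSpace ℝ (Fin d) → ℝ) → EuclideanSpace ℝ (Fin d) →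
      EuclideanSpace ℝ (Fin d))
    {T : ℕ} (F : Fin T → EuclideanSpace ℝ (Fin d) → ℝ)
    (e : ℕ → EuclideanSpace ℝ (Fin d)) (u : 𝕌) :
    (t : ℕ) → t ≤ T → Fin t → EuclideanSpace ℝ (Fin d)
  | 0, _ => Fin.elim0
  | t + 1, h =>
      Fin.snoc (α := fun _ => EuclideanSpace ℝ (Fin d))
        (feedback π G F e u t (Nat.le_of_succ_le h))
        (G t (F ⟨t, h⟩) (π.act t (feedback π G F e u t (Nat.le_of_succ_le h)) u) + e t)

/-- The decision `w_t` of the policy in round `t`. -/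
noncomputable def decision {d : ℕ} {Ω : Set (EuclideanSpace ℝ (Fin d))} {𝕌 : Type*}
    [MeasurableSpace 𝕌] (π : Policy Ω 𝕌)
    (G : ℕ → (EuclideanSpace ℝ (Fin d) → ℝ) → EuclideanSpace ℝ (Fin d) →
      EuclideanSpace ℝ (Fin d))
    {T : ℕ} (F : Fin T → EuclideanSpace ℝ (Fin d) → ℝ)
    (e : ℕ → EuclideanSpace ℝ (Fin d)) (u : 𝕌) (t : Fin T) : EuclideanSpace ℝ (Fin d) :=
  π.act t (feedback π G F e u t t.isLt.le) u

/-- Dynamic regret of the policy against the loss sequence `F`. -/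
noncomputable def dynamicRegret {d : ℕ} {Ω : Set (EuclideanSpace ℝ (Fin d))} {𝕌 S : Type*}
    [MeasurableSpace 𝕌] [MeasurableSpace S] (μ : Measure S) (U : S → 𝕌)
    (ε : ℕ → S → EuclideanSpace ℝ (Fin d)) (π : Policy Ω 𝕌)
    (G : ℕ → (EuclideanSpace ℝ (Fin d) → ℝ) → EuclideanSpace ℝ (Fin d) →
      EuclideanSpace ℝ (Fin d))
    {T : ℕ} (F : Fin T → EuclideanSpace ℝ (Fin d) → ℝ) : ℝ :=
  (∫ s, ∑ t, F t (decision π G F (fun τ => ε τ s) (U s) t) ∂μ) - ∑ t, sInf (F t '' Ω)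

/-- Worst-case dynamic regret over a family `V` of loss sequences, as an extended real. -/
noncomputable def worstRegret {d : ℕ} {Ω : Set (EuclideanSpace ℝ (Fin d))} {𝕌 S : Type*}
    [MeasurableSpace 𝕌] [MeasurableSpace S] (μ : Measure S) (U : S → 𝕌)
    (ε : ℕ → S → EuclideanSpace ℝ (Fin d)) (π : Policy Ω 𝕌)
    (G : ℕ → (EuclideanSpace ℝ (Fin d) → ℝ) → EuclideanSpace ℝ (Fin d) →
      EuclideanSpace ℝ (Fin d))
    {T : ℕ} (V : Set (Fin T → EuclideanSpace ℝ (Fin d) → ℝ)) : EReal :=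
  ⨆ F ∈ V, (dynamicRegret μ U ε π G F : EReal)

/-! The hard instances use two cones `η * ‖x - a‖` and `η * ‖x - b‖` with distinct `a, b ∈ Ω` at
distance at most 1, chosen by one bit per batch of `Δ = ⌈T / B⌉` rounds. There are at most `B`
switches, each moving the unique minimizer by at most 1, so the path variation is at most `B`.

The subgradients of both cones have norm at most `η`. Flipping the bit of one batch therefore
changes the law of the history, at any time inside that batch, by a divergence of at most `Δ * K *
(2η)²` (`klDiv_history_le`, by the chain rule). With `η` of order `1 / √(K Δ)` this is at most 1/8,
so the policy cannot tell the two bits apart while the batch lasts. The two losses at any point add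
up to at least `η * dist a b`, so the two expected losses of a round add up to at least half of that
(`half_le_integral_add_integral_of_klDiv_le`).

Averaging over all bit vectors (`exists_le_sum_of_le_add_flipBit`) yields one sequence with total
loss at least `T * η * dist a b / 4`. Both cones have minimum 0 over `Ω`, so this loss is the
regret. It is of order `√(B T / K)`, which dominates `B^κ * T^(1-κ)` because `κ > 1/2` and `B ≤ T`;
one constant serves all `κ`. -/

/-! ### Two-point testing under a small Kullback-Leibler divergence. -/

lemma one_sub_le_two_mul_klFun_add {x : ℝ} (hx : 0 ≤ x) : 1 - x ≤ 2 * klFun x + 1 / 4 := by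
  rcases hx.eq_or_lt with rfl | hx
  · simp [klFun]; norm_num
  have hexp : Real.exp (-(1 / 2)) ≤ 5 / 8 := by
    rw [Real.exp_neg]
    have h2 : (8 / 5 : ℝ) ≤ Real.exp (1 / 2) := by
      have := Real.quadratic_le_exp_of_nonneg (x := 1 / 2) (by norm_num)
      linarith
    calc (Real.exp (1 / 2))⁻¹ ≤ (8 / 5 : ℝ)⁻¹ := by gcongr
      _ = 5 / 8 := by norm_num
  -- The claim is equivalent to `x * (1/2 - log x) ≤ 5/8`. The left side has maximum `exp (-1/2)`,
  -- and the tangent-line bound for `exp` gives exactly this.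
  have h1 := Real.add_one_le_exp (-(1 / 2) - Real.log x)
  rw [Real.exp_sub, Real.exp_log hx] at h1
  have h2 : x * (-(1 / 2) - Real.log x + 1) ≤ Real.exp (-(1 / 2)) := by
    calc _ ≤ x * (Real.exp (-(1 / 2)) / x) := by gcongr
      _ = _ := by field_simp
  rw [klFun_apply]
  nlinarith

/-- Plays the role of Pinsker's inequality: the difference is `∫ (1 - dP/dQ) * h ∂Q`, and the
pointwise bound on `1 - x` turns it into at most `2 * KL + 1/4`. -/
lemma integral_sub_integral_le_of_klDiv_le {X : Type*} [MeasurableSpace X] {P Q : Measure X}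
    [IsProbabilityMeasure P] [IsProbabilityMeasure Q] (hkl : klDiv P Q ≤ ENNReal.ofReal (1 / 8))
    {h : X → ℝ} (hm : Measurable h) (h0 : ∀ x, 0 ≤ h x) (h1 : ∀ x, h x ≤ 1) :
    ∫ x, h x ∂Q - ∫ x, h x ∂P ≤ 1 / 2 := by
  have hfin : klDiv P Q ≠ ∞ := (hkl.trans_lt ENNReal.ofReal_lt_top).ne
  obtain ⟨hac, hint⟩ := klDiv_ne_top_iff.mp hfin
  have hkl' : ∫ x, klFun (P.rnDeriv Q x).toReal ∂Q ≤ 1 / 8 := by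
    rw [← toReal_klDiv_eq_integral_klFun hac]
    exact ENNReal.toReal_le_of_le_ofReal (by norm_num) hkl
  have hintk : Integrable (fun x => klFun (P.rnDeriv Q x).toReal) Q :=
    (integrable_klFun_rnDeriv_iff hac).mpr hint
  have hb : ∀ (R : Measure X) [IsProbabilityMeasure R], Integrable h R := fun R _ =>
    Integrable.of_bound hm.aestronglyMeasurable 1
      (.of_forall fun x => by rw [Real.norm_eq_abs, abs_of_nonneg (h0 x)]; exact h1 x)
  have hP : ∫ x, (P.rnDeriv Q x).toReal * h x ∂Q = ∫ x, h x ∂P := integral_rnDeriv_smul hac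
  have hPi : Integrable (fun x => (P.rnDeriv Q x).toReal * h x) Q :=
    (integrable_rnDeriv_smul_iff hac).mpr (hb P)
  rw [← hP, ← integral_sub (hb Q) hPi]
  calc _ ≤ ∫ x, (2 * klFun (P.rnDeriv Q x).toReal + 1 / 4) ∂Q := by
        refine integral_mono ((hb Q).sub hPi) ((hintk.const_mul 2).add (integrable_const _)) ?_
        intro x
        have hx : 0 ≤ (P.rnDeriv Q x).toReal := ENNReal.toReal_nonneg
        have := one_sub_le_two_mul_klFun_add hx
        have hk := klFun_nonneg hx
        have e1 : h x - (P.rnDeriv Q x).toReal * h x = (1 - (P.rnDeriv Q x).toReal) * h x := by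
          ring
        simp only [e1]
        rcases le_total (P.rnDeriv Q x).toReal 1 with hle | hle
        · exact (mul_le_of_le_one_right (by linarith) (h1 x)).trans this
        · exact (mul_nonpos_of_nonpos_of_nonneg (by linarith) (h0 x)).trans (by positivity)
    _ = 2 * (∫ x, klFun (P.rnDeriv Q x).toReal ∂Q) + 1 / 4 := by
        rw [integral_add (hintk.const_mul 2) (integrable_const _), integral_const_mul]
        simp
    _ ≤ 1 / 2 := by linarith

/-- Two-point (Le Cam type) lower bound under a bound on the Kullback-Leibler divergence. -/
lemma half_le_integral_add_integral_of_klDiv_le {X : Type*} [MeasurableSpace X] {P Q : Measure X}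
    [IsProbabilityMeasure P] [IsProbabilityMeasure Q] (hkl : klDiv P Q ≤ ENNReal.ofReal (1 / 8))
    {f g : X → ℝ} (hf : Measurable f) (hfP : Integrable f P) (hgQ : Integrable g Q)
    (hf0 : ∀ x, 0 ≤ f x) (hg0 : ∀ x, 0 ≤ g x) {c : ℝ} (hc : 0 < c) (hfg : ∀ x, c ≤ f x + g x) :
    c / 2 ≤ ∫ x, f x ∂P + ∫ x, g x ∂Q := by
  -- Truncation gives a test function with values in `[0, 1]` that satisfies both `c * h ≤ f` and `c
  -- - c * h ≤ g`.
  set h : X → ℝ := fun x => min (f x / c) 1 with hh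
  have hm : Measurable h := (hf.div_const c).min measurable_const
  have h0 : ∀ x, 0 ≤ h x := fun x => le_min (div_nonneg (hf0 x) hc.le) zero_le_one
  have h1 : ∀ x, h x ≤ 1 := fun x => min_le_right _ _
  have hb : ∀ (R : Measure X) [IsProbabilityMeasure R], Integrable h R := fun R _ =>
    Integrable.of_bound hm.aestronglyMeasurable 1
      (.of_forall fun x => by rw [Real.norm_eq_abs, abs_of_nonneg (h0 x)]; exact h1 x)
  have key := integral_sub_integral_le_of_klDiv_le hkl hm h0 h1
  have hfh : c * ∫ x, h x ∂P ≤ ∫ x, f x ∂P := by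
    rw [← integral_const_mul]
    refine integral_mono ((hb P).const_mul c) hfP fun x => ?_
    have : h x ≤ f x / c := min_le_left _ _
    rw [le_div_iff₀ hc] at this
    linarith
  have hgh : c - c * ∫ x, h x ∂Q ≤ ∫ x, g x ∂Q := by
    have e : ∫ x, (c - c * h x) ∂Q = c - c * ∫ x, h x ∂Q := by
      rw [integral_sub (integrable_const _) ((hb Q).const_mul c), integral_const_mul]
      simp
    rw [← e]
    refine integral_mono ((integrable_const _).sub ((hb Q).const_mul c)) hgQ fun x => ?_
    rcases le_total (f x / c) 1 with hle | hle
    · have : h x = f x / c := min_eq_left hle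
      have e2 : c * (f x / c) = f x := by field_simp
      simp only [this, e2]
      linarith [hfg x]
    · have : h x = 1 := min_eq_right hle
      simp only [this]
      linarith [hg0 x]
  nlinarith

/-! ### Conditional divergence and regrouping of independent variables. -/

/-- The conditional Kullback-Leibler divergence is bounded by a pointwise bound. -/
lemma klDiv_compProd_right_le {X Y : Type*} [MeasurableSpace X] [MeasurableSpace Y]
    [MeasurableSpace.CountablyGenerated Y] (P : Measure X) [IsProbabilityMeasure P]
    (κ η : Kernel X Y) [IsMarkovKernel κ] [IsMarkovKernel η] {c : ℝ≥0∞} (hc : c ≠ ∞)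
    (h : ∀ x, klDiv (κ x) (η x) ≤ c) : klDiv (P ⊗ₘ κ) (P ⊗ₘ η) ≤ c := by
  have hac : ∀ x, κ x ≪ η x := fun x =>
    (klDiv_ne_top_iff.mp ((h x).trans_lt hc.lt_top).ne).1
  -- The kernel derivative is jointly measurable, so it also serves as the density of the two
  -- composition products; the divergence then disintegrates over `P`.
  have hκ : η.withDensity (κ.rnDeriv η) = κ := by
    ext1 x
    exact Kernel.withDensity_rnDeriv_eq (hac x)
  have hacP : P ⊗ₘ κ ≪ P ⊗ₘ η := Measure.AbsolutelyContinuous.compProd_right (.of_forall hac)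
  have hmeas : Measurable (fun p : X × Y => κ.rnDeriv η p.1 p.2) := κ.measurable_rnDeriv η
  have hd : (P ⊗ₘ η).withDensity (fun p : X × Y => κ.rnDeriv η p.1 p.2) = P ⊗ₘ κ := by
    have : IsSFiniteKernel (η.withDensity (κ.rnDeriv η)) := by rw [hκ]; infer_instance
    rw [← Measure.compProd_withDensity hmeas]
    rw [hκ]
  have hr : (P ⊗ₘ κ).rnDeriv (P ⊗ₘ η) =ᵐ[P ⊗ₘ η] fun p => κ.rnDeriv η p.1 p.2 := by
    rw [← hd]
    exact Measure.rnDeriv_withDensity _ hmeas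
  rw [klDiv_eq_lintegral_klFun_of_ac hacP]
  calc _ = ∫⁻ p, ENNReal.ofReal (klFun (κ.rnDeriv η p.1 p.2).toReal) ∂(P ⊗ₘ η) := by
        refine lintegral_congr_ae ?_
        filter_upwards [hr] with p hp
        rw [hp]
    _ = ∫⁻ x, ∫⁻ y, ENNReal.ofReal (klFun (κ.rnDeriv η x y).toReal) ∂(η x) ∂P := by
        rw [Measure.lintegral_compProd]
        exact (measurable_klFun.comp hmeas.ennreal_toReal).ennreal_ofReal
    _ = ∫⁻ x, klDiv (κ x) (η x) ∂P := by
        refine lintegral_congr fun x => ?_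
        rw [klDiv_eq_lintegral_klFun_of_ac (hac x)]
        refine lintegral_congr_ae ?_
        filter_upwards [Kernel.rnDeriv_eq_rnDeriv_measure (κ := κ) (η := η) (a := x)] with y hy
        rw [hy]
    _ ≤ ∫⁻ _, c ∂P := lintegral_mono h
    _ = c := by simp

lemma indepFun_prodMk_of_indepFun {S X Y Z : Type*} [MeasurableSpace S] [MeasurableSpace X]
    [MeasurableSpace Y] [MeasurableSpace Z] {μ : Measure S} [IsProbabilityMeasure μ]
    {f : S → X} {g : S → Y} {h : S → Z} (hf : Measurable f) (hg : Measurable g)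
    (hh : Measurable h) (hfgh : IndepFun f (fun s => (g s, h s)) μ) (hgh : IndepFun g h μ) :
    IndepFun (fun s => (f s, g s)) h μ := by
  have hfg : IndepFun f g μ := hfgh.comp measurable_id measurable_fst
  rw [indepFun_iff_map_prod_eq_prod_map_map (hf.prodMk hg).aemeasurable hh.aemeasurable]
  rw [indepFun_iff_map_prod_eq_prod_map_map hf.aemeasurable (hg.prodMk hh).aemeasurable] at hfgh
  rw [indepFun_iff_map_prod_eq_prod_map_map hg.aemeasurable hh.aemeasurable] at hgh
  rw [indepFun_iff_map_prod_eq_prod_map_map hf.aemeasurable hg.aemeasurable] at hfg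
  have := Measure.isProbabilityMeasure_map (μ := μ) hf.aemeasurable
  have := Measure.isProbabilityMeasure_map (μ := μ) hg.aemeasurable
  have := Measure.isProbabilityMeasure_map (μ := μ) hh.aemeasurable
  have e : (fun s => ((f s, g s), h s))
      = MeasurableEquiv.prodAssoc.symm ∘ (fun s => (f s, (g s, h s))) := rfl
  rw [e, ← Measure.map_map MeasurableEquiv.prodAssoc.symm.measurable
    (hf.prodMk (hg.prodMk hh)), hfgh, hgh, hfg]
  rw [← Measure.prodAssoc_prod, Measure.map_map (by fun_prop) (by fun_prop)]
  simp

/-! ### Laws of the feedback history and their divergence. -/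

section Feedback

variable {d : ℕ} {Ω : Set (EuclideanSpace ℝ (Fin d))} {𝕌 S : Type*} [MeasurableSpace 𝕌]
  [MeasurableSpace S]

lemma feedback_congr (π : Policy Ω 𝕌)
    (G : ℕ → (EuclideanSpace ℝ (Fin d) → ℝ) → EuclideanSpace ℝ (Fin d) → EuclideanSpace ℝ (Fin d))
    {T : ℕ} (F : Fin T → EuclideanSpace ℝ (Fin d) → ℝ) {e e' : ℕ → EuclideanSpace ℝ (Fin d)}
    (u : 𝕌) (t : ℕ) (ht : t ≤ T) (h : ∀ τ < t, e τ = e' τ) :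
    feedback π G F e u t ht = feedback π G F e' u t ht := by
  induction t with
  | zero => rfl
  | succ t ih =>
    rw [feedback, feedback, ih (Nat.le_of_succ_le ht) fun τ hτ => h τ (hτ.trans t.lt_succ_self),
      h t t.lt_succ_self]

lemma measurable_snoc {E : Type*} [MeasurableSpace E] (t : ℕ) :
    Measurable (fun p : (Fin t → E) × E =>
      (Fin.snoc (α := fun _ => E) p.1 p.2 : Fin (t + 1) → E)) := by
  refine measurable_pi_lambda _ fun i => ?_
  refine Fin.lastCases ?_ (fun j => ?_) i
  · simpa using measurable_snd
  · simp only [Fin.snoc_castSucc]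
    fun_prop

lemma measurable_snoc_history {E V : Type*} [MeasurableSpace E] [MeasurableSpace V] (t : ℕ) :
    Measurable (fun p : ((Fin t → E) × V) × E =>
      ((Fin.snoc (α := fun _ => E) p.1.1 p.2 : Fin (t + 1) → E), p.1.2)) :=
  ((measurable_snoc t).comp ((measurable_fst.comp measurable_fst).prodMk measurable_snd)).prodMk
    (measurable_snd.comp measurable_fst)

lemma measurable_feedback (π : Policy Ω 𝕌)
    {G : ℕ → (EuclideanSpace ℝ (Fin d) → ℝ) → EuclideanSpace ℝ (Fin d) → EuclideanSpace ℝ (Fin d)}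
    {T : ℕ} {F : Fin T → EuclideanSpace ℝ (Fin d) → ℝ} (hG : ∀ t : Fin T, Measurable (G t (F t)))
    (t : ℕ) (ht : t ≤ T) :
    Measurable (fun p : (ℕ → EuclideanSpace ℝ (Fin d)) × 𝕌 => feedback π G F p.1 p.2 t ht) := by
  induction t with
  | zero => exact measurable_pi_lambda _ fun i => i.elim0
  | succ t ih =>
    have ih := ih (Nat.le_of_succ_le ht)
    have h1 := (hG ⟨t, ht⟩).comp ((π.measurable_act t).comp (ih.prodMk measurable_snd))
    have h2 : Measurable (fun p : (ℕ → EuclideanSpace ℝ (Fin d)) × 𝕌 => p.1 t) :=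
      (measurable_pi_apply t).comp measurable_fst
    exact (measurable_snoc t).comp (ih.prodMk (h1.add h2))

/-- The feedback of the first `t` rounds together with the internal randomness of the policy. -/
noncomputable def history (U : S → 𝕌) (ε : ℕ → S → EuclideanSpace ℝ (Fin d)) (π : Policy Ω 𝕌)
    (G : ℕ → (EuclideanSpace ℝ (Fin d) → ℝ) → EuclideanSpace ℝ (Fin d) → EuclideanSpace ℝ (Fin d))
    {T : ℕ} (F : Fin T → EuclideanSpace ℝ (Fin d) → ℝ) (t : ℕ) (ht : t ≤ T) (s : S) :
    (Fin t → EuclideanSpace ℝ (Fin d)) × 𝕌 :=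
  (feedback π G F (fun τ => ε τ s) (U s) t ht, U s)

lemma measurable_history {U : S → 𝕌} (hU : Measurable U) {ε : ℕ → S → EuclideanSpace ℝ (Fin d)}
    (hε : ∀ t, Measurable (ε t)) (π : Policy Ω 𝕌)
    {G : ℕ → (EuclideanSpace ℝ (Fin d) → ℝ) → EuclideanSpace ℝ (Fin d) → EuclideanSpace ℝ (Fin d)}
    {T : ℕ} {F : Fin T → EuclideanSpace ℝ (Fin d) → ℝ} (hG : ∀ t : Fin T, Measurable (G t (F t)))
    (t : ℕ) (ht : t ≤ T) : Measurable (history U ε π G F t ht) :=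
  ((measurable_feedback π hG t ht).comp ((measurable_pi_lambda _ hε).prodMk hU)).prodMk hU

lemma indepFun_history {U : S → 𝕌} (hU : Measurable U) {ε : ℕ → S → EuclideanSpace ℝ (Fin d)}
    (hε : ∀ t, Measurable (ε t)) {μ : Measure S} [IsProbabilityMeasure μ] (hind : iIndepFun ε μ)
    (hUε : IndepFun U (fun s t => ε t s) μ) (π : Policy Ω 𝕌)
    {G : ℕ → (EuclideanSpace ℝ (Fin d) → ℝ) → EuclideanSpace ℝ (Fin d) → EuclideanSpace ℝ (Fin d)}
    {T : ℕ} {F : Fin T → EuclideanSpace ℝ (Fin d) → ℝ} (hG : ∀ t : Fin T, Measurable (G t (F t)))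
    (t : ℕ) (ht : t ≤ T) : IndepFun (history U ε π G F t ht) (ε t) μ := by
  set past : S → Finset.range t → EuclideanSpace ℝ (Fin d) := fun s τ => ε τ s with hpast
  have hpm : Measurable past := measurable_pi_lambda _ fun τ => hε τ
  have h1 : IndepFun past (ε t) μ := by
    have := hind.indepFun_finset (Finset.range t) {t} (by simp) hε
    exact this.comp (φ := id) (ψ := fun v : ({t} : Finset ℕ) → EuclideanSpace ℝ (Fin d) =>
      v ⟨t, by simp⟩) measurable_id (measurable_pi_apply _)
  have h2 : IndepFun U (fun s => (past s, ε t s)) μ :=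
    hUε.comp (φ := id) (ψ := fun v : ℕ → EuclideanSpace ℝ (Fin d) =>
      ((fun τ : Finset.range t => v τ), v t)) measurable_id (by fun_prop)
  have h3 := indepFun_prodMk_of_indepFun hU hpm (hε t) h2 h1
  -- `feedback` expects an infinite noise sequence. Padding the past with zeros is harmless, since
  -- the first `t` feedback vectors read only the noise before `t`; it exhibits the history as a
  -- function of `U` and the past alone.
  set ext : (Finset.range t → EuclideanSpace ℝ (Fin d)) → ℕ → EuclideanSpace ℝ (Fin d) :=
    fun v τ => if h : τ ∈ Finset.range t then v ⟨τ, h⟩ else 0 with hext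
  have hem : Measurable ext := by
    refine measurable_pi_lambda _ fun τ => ?_
    by_cases h : τ ∈ Finset.range t
    · simp only [hext, dif_pos h]
      fun_prop
    · simp only [hext, dif_neg h]
      fun_prop
  have hφ : Measurable (fun p : 𝕌 × (Finset.range t → EuclideanSpace ℝ (Fin d)) =>
      (feedback π G F (ext p.2) p.1 t ht, p.1)) :=
    ((measurable_feedback π hG t ht).comp
      ((hem.comp measurable_snd).prodMk measurable_fst)).prodMk measurable_fst
  suffices history U ε π G F t ht = (fun p : 𝕌 × (Finset.range t → EuclideanSpace ℝ (Fin d)) =>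
      (feedback π G F (ext p.2) p.1 t ht, p.1)) ∘ fun s => (U s, past s) by
    rw [this]
    exact h3.comp hφ measurable_id
  funext s
  refine Prod.ext (feedback_congr π G F _ t ht fun τ hτ => ?_) rfl
  simp [hext, hτ, hpast]

/-- The conditional law of an observation `v x + e` given `x`, where the noise `e` has law `P`. -/
noncomputable def shiftKernel {X : Type*} [MeasurableSpace X]
    (P : Measure (EuclideanSpace ℝ (Fin d))) [SFinite P] (v : X → EuclideanSpace ℝ (Fin d)) :
    Kernel X (EuclideanSpace ℝ (Fin d)) :=
  (Kernel.id ×ₖ Kernel.const X P).map fun p => v p.1 + p.2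

lemma shiftKernel_apply {X : Type*} [MeasurableSpace X]
    (P : Measure (EuclideanSpace ℝ (Fin d))) [SFinite P] {v : X → EuclideanSpace ℝ (Fin d)}
    (hv : Measurable v) (x : X) : shiftKernel P v x = P.map (v x + ·) := by
  have hm : Measurable (fun p : X × EuclideanSpace ℝ (Fin d) => v p.1 + p.2) := by fun_prop
  rw [shiftKernel, Kernel.map_apply _ hm, Kernel.prod_apply, Kernel.id_apply, Kernel.const_apply,
    Measure.dirac_prod, Measure.map_map hm (by fun_prop)]
  rfl

lemma isMarkovKernel_shiftKernel {X : Type*} [MeasurableSpace X]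
    (P : Measure (EuclideanSpace ℝ (Fin d))) [IsProbabilityMeasure P]
    {v : X → EuclideanSpace ℝ (Fin d)} (hv : Measurable v) : IsMarkovKernel (shiftKernel P v) :=
  Kernel.IsMarkovKernel.map _ (by fun_prop)

lemma compProd_shiftKernel {X : Type*} [MeasurableSpace X] (ν : Measure X) [SFinite ν]
    (P : Measure (EuclideanSpace ℝ (Fin d))) [IsProbabilityMeasure P]
    {v : X → EuclideanSpace ℝ (Fin d)} (hv : Measurable v) :
    ν ⊗ₘ shiftKernel P v = (ν.prod P).map (fun p => (p.1, v p.1 + p.2)) := by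
  have := isMarkovKernel_shiftKernel P hv
  have hm : Measurable (fun p : X × EuclideanSpace ℝ (Fin d) => (p.1, v p.1 + p.2)) := by fun_prop
  ext A hA
  rw [Measure.compProd_apply hA, Measure.map_apply hm hA, Measure.prod_apply (hm hA)]
  refine lintegral_congr fun x => ?_
  rw [shiftKernel_apply P hv, Measure.map_apply (by fun_prop) (measurable_prodMk_left hA)]
  rfl

/-- Translating both laws by the common vector `v x` cannot increase the divergence (data
processing), so only the difference of the two shifts matters. -/
lemma klDiv_shiftKernel_le {X : Type*} [MeasurableSpace X]
    (P : Measure (EuclideanSpace ℝ (Fin d))) [IsProbabilityMeasure P]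
    {v w : X → EuclideanSpace ℝ (Fin d)} (hv : Measurable v) (hw : Measurable w) (x : X) :
    klDiv (shiftKernel P v x) (shiftKernel P w x) ≤ klDiv P (P.map (· - (v x - w x))) := by
  rw [shiftKernel_apply P hv, shiftKernel_apply P hw]
  have e : P.map (w x + ·) = (P.map (· - (v x - w x))).map (v x + ·) := by
    rw [Measure.map_map (by fun_prop) (by fun_prop)]
    congr 1
    funext y
    simp only [Function.comp_apply]
    abel
  rw [e]
  have := Measure.isProbabilityMeasure_map (μ := P) (f := (· - (v x - w x))) (by fun_prop)
  exact klDiv_map_le _ _ (by fun_prop)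

/-- The noiseless subgradient of round `t` as a function of the history. -/
def pastSubgradient (π : Policy Ω 𝕌)
    (G : ℕ → (EuclideanSpace ℝ (Fin d) → ℝ) → EuclideanSpace ℝ (Fin d) → EuclideanSpace ℝ (Fin d))
    (t : ℕ) (f : EuclideanSpace ℝ (Fin d) → ℝ) (x : (Fin t → EuclideanSpace ℝ (Fin d)) × 𝕌) :
    EuclideanSpace ℝ (Fin d) :=
  G t f (π.act t x.1 x.2)

/-- Fresh noise is independent of the history, so a round acts on the law of the history as a Markov
kernel; this is the form the chain rule needs. -/
lemma map_history_succ {U : S → 𝕌} (hU : Measurable U) {ε : ℕ → S → EuclideanSpace ℝ (Fin d)}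
    (hε : ∀ t, Measurable (ε t)) {μ : Measure S} [IsProbabilityMeasure μ] (hind : iIndepFun ε μ)
    (hUε : IndepFun U (fun s t => ε t s) μ) (π : Policy Ω 𝕌)
    {G : ℕ → (EuclideanSpace ℝ (Fin d) → ℝ) → EuclideanSpace ℝ (Fin d) → EuclideanSpace ℝ (Fin d)}
    {T : ℕ} {F : Fin T → EuclideanSpace ℝ (Fin d) → ℝ} (hG : ∀ t : Fin T, Measurable (G t (F t)))
    (t : ℕ) (ht : t + 1 ≤ T) :
    μ.map (history U ε π G F (t + 1) ht) =
      (μ.map (history U ε π G F t (Nat.le_of_succ_le ht)) ⊗ₘ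
        shiftKernel (μ.map (ε t)) (pastSubgradient π G t (F ⟨t, ht⟩))).map
          (fun p => ((Fin.snoc (α := fun _ => EuclideanSpace ℝ (Fin d)) p.1.1 p.2 :
            Fin (t + 1) → EuclideanSpace ℝ (Fin d)), p.1.2)) := by
  have hH := measurable_history hU hε π hG t (Nat.le_of_succ_le ht)
  have hv : Measurable (pastSubgradient π G t (F ⟨t, ht⟩)) :=
    (hG ⟨t, ht⟩).comp (π.measurable_act t)
  have := Measure.isProbabilityMeasure_map (μ := μ) (hε t).aemeasurable
  have := Measure.isProbabilityMeasure_map (μ := μ) hH.aemeasurable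
  rw [compProd_shiftKernel _ _ hv,
    ← (indepFun_iff_map_prod_eq_prod_map_map hH.aemeasurable (hε t).aemeasurable).mp
      (indepFun_history hU hε hind hUε π hG t (Nat.le_of_succ_le ht)),
    Measure.map_map (by fun_prop) (hH.prodMk (hε t)),
    Measure.map_map (measurable_snoc_history t) (by fun_prop)]
  rfl

/-- If the loss sequences `F`, `F'` lead to subgradients that differ by at most `r`, then each round
in which they differ adds at most `K * r ^ 2` to the Kullback-Leibler divergence between
the laws of the histories. -/
lemma klDiv_history_le {U : S → 𝕌} (hU : Measurable U) {ε : ℕ → S → EuclideanSpace ℝ (Fin d)}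
    {μ : Measure S} [IsProbabilityMeasure μ] {lam K : ℝ} (hK : 0 ≤ K) (hε : IsNoise μ ε lam K)
    (hUε : IndepFun U (fun s t => ε t s) μ) (π : Policy Ω 𝕌)
    {G : ℕ → (EuclideanSpace ℝ (Fin d) → ℝ) → EuclideanSpace ℝ (Fin d) → EuclideanSpace ℝ (Fin d)}
    {T : ℕ} {F F' : Fin T → EuclideanSpace ℝ (Fin d) → ℝ}
    (hG : ∀ t : Fin T, Measurable (G t (F t))) (hG' : ∀ t : Fin T, Measurable (G t (F' t)))
    {r : ℝ} (D : Finset ℕ) (hD : ∀ t : Fin T, (t : ℕ) ∉ D → F t = F' t)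
    (hr : ∀ (t : Fin T), ∀ w ∈ Ω, ‖G t (F t) w - G t (F' t) w‖ ≤ r) (t : ℕ) (ht : t ≤ T) :
    klDiv (μ.map (history U ε π G F t ht)) (μ.map (history U ε π G F' t ht)) ≤
      (D.filter (· < t)).card * ENNReal.ofReal (K * r ^ 2) := by
  induction t with
  | zero =>
    -- Before any feedback the history is just the internal randomness, which does not see the
    -- losses.
    have e : history U ε π G F 0 ht = history U ε π G F' 0 ht := rfl
    have := Measure.isProbabilityMeasure_map (μ := μ)
      (measurable_history hU hε.measurable π hG' 0 ht).aemeasurable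
    rw [e, klDiv_self]
    exact zero_le
  | succ t ih =>
    have ih := ih (Nat.le_of_succ_le ht)
    have hH := measurable_history hU hε.measurable π hG t (Nat.le_of_succ_le ht)
    have hH' := measurable_history hU hε.measurable π hG' t (Nat.le_of_succ_le ht)
    have hv : Measurable (pastSubgradient π G t (F ⟨t, ht⟩)) :=
      (hG ⟨t, ht⟩).comp (π.measurable_act t)
    have hv' : Measurable (pastSubgradient π G t (F' ⟨t, ht⟩)) :=
      (hG' ⟨t, ht⟩).comp (π.measurable_act t)
    have := Measure.isProbabilityMeasure_map (μ := μ) (hε.measurable t).aemeasurable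
    have := Measure.isProbabilityMeasure_map (μ := μ) hH.aemeasurable
    have := Measure.isProbabilityMeasure_map (μ := μ) hH'.aemeasurable
    have := isMarkovKernel_shiftKernel (μ.map (ε t)) hv
    have := isMarkovKernel_shiftKernel (μ.map (ε t)) hv'
    rw [map_history_succ hU hε.measurable hε.indep hUε π hG t ht,
      map_history_succ hU hε.measurable hε.indep hUε π hG' t ht]
    refine (klDiv_map_le _ _ (measurable_snoc_history t)).trans ?_
    rw [klDiv_compProd_eq_add]
    -- After the chain rule, a round in `D` adds its conditional divergence; outside `D` the two
    -- kernels coincide and add nothing.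
    by_cases htD : t ∈ D
    · have hcard : (D.filter (· < t + 1)).card = (D.filter (· < t)).card + 1 := by
        rw [← Finset.card_insert_of_notMem (a := t) (s := D.filter (· < t)) (by simp)]
        congr 1
        ext τ
        simp only [Finset.mem_filter, Finset.mem_insert]
        grind
      rw [hcard, Nat.cast_succ, add_mul, one_mul]
      refine add_le_add ih (klDiv_compProd_right_le _ _ _ ENNReal.ofReal_ne_top fun x => ?_)
      refine (klDiv_shiftKernel_le _ hv hv' x).trans ?_
      rw [Measure.map_map (by fun_prop) (hε.measurable t)]
      refine (hε.kl_le t _).trans (ENNReal.ofReal_le_ofReal ?_)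
      gcongr
      exact hr ⟨t, ht⟩ _ (π.act_mem t x.1 x.2)
    · have hcard : D.filter (· < t + 1) = D.filter (· < t) := by
        ext τ
        simp only [Finset.mem_filter]
        grind
      rw [hcard, hD ⟨t, ht⟩ htD, klDiv_self, add_zero]
      exact ih

end Feedback

/-! ### Cone losses and the path variation of batched sequences. -/

section Cone

variable {d : ℕ} {Ω : Set (EuclideanSpace ℝ (Fin d))}

/-- The cone-shaped loss `x ↦ η ‖x - a‖`. -/
noncomputable def cone (η : ℝ) (a x : EuclideanSpace ℝ (Fin d)) : ℝ := η * ‖x - a‖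

lemma cone_nonneg {η : ℝ} (hη : 0 ≤ η) (a x : EuclideanSpace ℝ (Fin d)) : 0 ≤ cone η a x :=
  mul_nonneg hη (norm_nonneg _)

lemma measurable_cone (η : ℝ) (a : EuclideanSpace ℝ (Fin d)) : Measurable (cone η a) := by
  unfold cone
  fun_prop

lemma convexOn_cone {η : ℝ} (hη : 0 ≤ η) (a : EuclideanSpace ℝ (Fin d)) :
    ConvexOn ℝ Set.univ (cone η a) := by
  have h : ConvexOn ℝ Set.univ fun x : EuclideanSpace ℝ (Fin d) => dist x a :=
    convexOn_dist a convex_univ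
  have e : cone η a = fun x => η • dist x a := by
    funext x
    rw [cone, dist_eq_norm, smul_eq_mul]
  rw [e]
  exact h.smul hη

lemma minimizers_cone {η : ℝ} (hη : 0 < η) {a : EuclideanSpace ℝ (Fin d)} (ha : a ∈ Ω) :
    minimizers Ω (cone η a) = {a} := by
  ext w
  simp only [minimizers, Set.mem_ofPred_eq, Set.mem_singleton_iff]
  constructor
  · rintro ⟨-, hw⟩
    have h : cone η a w ≤ cone η a a := hw ha
    simp only [cone, sub_self, norm_zero, mul_zero] at h
    have : ‖w - a‖ ≤ 0 := by
      by_contra hn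
      exact absurd h (not_le.mpr (mul_pos hη (not_le.mp hn)))
    exact sub_eq_zero.mp (norm_le_zero_iff.mp this)
  · rintro rfl
    refine ⟨ha, fun x _ => ?_⟩
    simpa [cone] using mul_nonneg hη.le (norm_nonneg (x - w))

lemma sInf_cone_image {η : ℝ} (hη : 0 ≤ η) {a : EuclideanSpace ℝ (Fin d)} (ha : a ∈ Ω) :
    sInf (cone η a '' Ω) = 0 := by
  refine IsLeast.csInf_eq ⟨⟨a, ha, by simp [cone]⟩, ?_⟩
  rintro _ ⟨x, -, rfl⟩
  exact cone_nonneg hη a x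

/-- A cone is affine on the segment from its apex to `b`, so the midpoint inequality leaves no room
for a quadratic gain. -/
lemma not_strongConvexOn_cone (η : ℝ) {a b : EuclideanSpace ℝ (Fin d)} (ha : a ∈ Ω) (hb : b ∈ Ω)
    (hab : a ≠ b) {m : ℝ} (hm : 0 < m) : ¬ StrongConvexOn Ω m (cone η a) := by
  intro h
  have h2 := h.2 ha hb (show (0 : ℝ) ≤ 1 / 2 by norm_num) (show (0 : ℝ) ≤ 1 / 2 by norm_num)
    (by norm_num)
  have e : (1 / 2 : ℝ) • a + (1 / 2 : ℝ) • b - a = (1 / 2 : ℝ) • (b - a) := by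
    module
  simp only [cone, e, norm_smul, sub_self, norm_zero, smul_eq_mul] at h2
  have hpos : 0 < ‖a - b‖ := norm_pos_iff.mpr (sub_ne_zero.mpr hab)
  have : 0 < m * ‖a - b‖ ^ 2 := by positivity
  norm_num at h2
  nlinarith

/-- The subgradient inequality at the test point `w + v` gives `‖v‖² ≤ η * ‖v‖`. -/
lemma norm_le_of_mem_subdifferential_cone {η : ℝ} (hη : 0 ≤ η)
    {a w v : EuclideanSpace ℝ (Fin d)} (hv : v ∈ subdifferential (cone η a) w) : ‖v‖ ≤ η := by
  have h := hv (w + v)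
  simp only [cone, add_sub_cancel_left, real_inner_self_eq_norm_sq] at h
  have h2 : ‖w + v - a‖ ≤ ‖w - a‖ + ‖v‖ := by
    rw [show w + v - a = (w - a) + v by abel]
    exact norm_add_le _ _
  by_contra hn
  nlinarith [mul_le_mul_of_nonneg_left h2 hη, norm_nonneg v]

lemma mul_dist_le_cone_add_cone {η : ℝ} (hη : 0 ≤ η) (a b x : EuclideanSpace ℝ (Fin d)) :
    η * dist a b ≤ cone η a x + cone η b x := by
  rw [cone, cone, ← mul_add]
  gcongr
  rw [← dist_eq_norm, ← dist_eq_norm, dist_comm x a]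
  exact dist_triangle a x b

/-- Minimizers are unique and can move only when round `t + 1` opens a new batch, that is when `Δ ∣
t + 1`; the count is that of the multiples of `Δ` in `1, …, T - 1`. -/
lemma pathVariation_le_of_mem_batchFamily {η : ℝ} (hη : 0 < η) {a b : EuclideanSpace ℝ (Fin d)}
    (ha : a ∈ Ω) (hb : b ∈ Ω) {T Δ : ℕ} {F : Fin T → EuclideanSpace ℝ (Fin d) → ℝ}
    (hF : F ∈ batchFamily T Δ (cone η a) (cone η b)) :
    pathVariation Ω F ≤ ((T - 1) / Δ : ℕ) * edist a b := by
  obtain ⟨c, hc⟩ := hF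
  refine iSup₂_le fun w hw => ?_
  have hw' : ∀ t < T, w t = if c (t / Δ) then a else b := by
    intro t ht
    have h := hw ⟨t, ht⟩
    rw [hc] at h
    dsimp only at h
    split_ifs at h ⊢
    · rwa [minimizers_cone hη ha] at h
    · rwa [minimizers_cone hη hb] at h
  calc ∑ t ∈ Finset.range (T - 1), edist (w t) (w (t + 1))
      ≤ ∑ t ∈ Finset.range (T - 1), if Δ ∣ t + 1 then edist a b else 0 := by
        refine Finset.sum_le_sum fun t ht => ?_
        rw [Finset.mem_range] at ht
        rw [hw' t (by omega), hw' (t + 1) (by omega)]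
        by_cases hd : Δ ∣ t + 1
        · rw [if_pos hd]
          split_ifs <;> simp [edist_comm]
        · rw [Nat.succ_div_of_not_dvd hd]
          simp
    _ = ((T - 1) / Δ : ℕ) * edist a b := by
        rw [← Finset.sum_filter, Finset.sum_const, Nat.card_multiples, nsmul_eq_mul]

lemma batchFamily_subset_pathVariationClass {η : ℝ} (hη : 0 < η) {a b : EuclideanSpace ℝ (Fin d)}
    (ha : a ∈ Ω) (hb : b ∈ Ω) {T Δ : ℕ} {B : ℝ} (hB : ((T - 1) / Δ : ℕ) * dist a b ≤ B) :
    batchFamily T Δ (cone η a) (cone η b) ⊆ pathVariationClass Ω T B := by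
  intro F hF
  obtain ⟨c, hc⟩ := id hF
  refine ⟨fun t => ?_, fun t => ?_, (pathVariation_le_of_mem_batchFamily hη ha hb hF).trans ?_⟩
  · rw [hc]
    split_ifs
    exacts [convexOn_cone hη.le a, convexOn_cone hη.le b]
  · rw [hc]
    split_ifs
    · rw [minimizers_cone hη ha]; exact Set.singleton_nonempty a
    · rw [minimizers_cone hη hb]; exact Set.singleton_nonempty b
  · rw [edist_dist, ← ENNReal.ofReal_natCast, ← ENNReal.ofReal_mul (Nat.cast_nonneg _)]
    exact ENNReal.ofReal_le_ofReal hB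

end Cone

/-! ### Averaging over bit vectors. -/

/-- The bit vector obtained from `c` by flipping the `j`-th bit. -/
def flipBit {ι : Type*} [DecidableEq ι] (j : ι) (c : ι → Bool) : ι → Bool :=
  Function.update c j (!c j)

lemma involutive_flipBit {ι : Type*} [DecidableEq ι] (j : ι) :
    Function.Involutive (flipBit j) := by
  intro c
  simp [flipBit]

/-- If flipping one bit, which may depend on the round, makes the losses of every round add up to at
least `2 * r`, then some bit vector has a total loss of at least `r` per round. -/
lemma exists_le_sum_of_le_add_flipBit {ι τ : Type*} [DecidableEq ι] [Fintype ι] [Fintype τ]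
    (j : τ → ι) (L : τ → (ι → Bool) → ℝ) {r : ℝ}
    (h : ∀ t c, 2 * r ≤ L t c + L t (flipBit (j t) c)) :
    ∃ c, Fintype.card τ * r ≤ ∑ t, L t c := by
  by_contra! hcon
  have h1 : ∑ c : ι → Bool, ∑ t, L t c < ∑ _c : ι → Bool, Fintype.card τ * r :=
    Finset.sum_lt_sum_of_nonempty Finset.univ_nonempty fun c _ => hcon c
  have h2 : ∀ t, ∑ _c : ι → Bool, r ≤ ∑ c, L t c := by
    intro t
    -- Flipping a fixed bit permutes the bit vectors.
    have e : ∑ c, L t (flipBit (j t) c) = ∑ c, L t c :=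
      Equiv.sum_comp (involutive_flipBit (j t)).toPerm (L t)
    have h3 : ∑ c : ι → Bool, 2 * r ≤ ∑ c, (L t c + L t (flipBit (j t) c)) :=
      Finset.sum_le_sum fun c _ => h t c
    rw [Finset.sum_add_distrib, e, ← Finset.mul_sum] at h3
    linarith
  have h4 : ∑ _t : τ, ∑ _c : ι → Bool, r ≤ ∑ t, ∑ c, L t c := Finset.sum_le_sum fun t _ => h2 t
  rw [Finset.sum_comm (f := fun t c => L t c)] at h4
  simp only [Finset.sum_const, nsmul_eq_mul, Finset.card_univ] at h1 h4
  linarith [mul_left_comm (Fintype.card (ι → Bool) : ℝ) (Fintype.card τ) r]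

/-! ### Regret of the batched cones. -/

section Regret

variable {d : ℕ} {Ω : Set (EuclideanSpace ℝ (Fin d))} {𝕌 S : Type*} [MeasurableSpace 𝕌]
  [MeasurableSpace S]

/-- The batched loss sequence determined by a bit vector. -/
def batchSequence (T Δ : ℕ) (f g : EuclideanSpace ℝ (Fin d) → ℝ) (c : Fin T → Bool) (t : Fin T) :
    EuclideanSpace ℝ (Fin d) → ℝ :=
  if c ⟨t / Δ, (Nat.div_le_self _ _).trans_lt t.isLt⟩ then f else g

lemma batchSequence_mem (T Δ : ℕ) (f g : EuclideanSpace ℝ (Fin d) → ℝ) (c : Fin T → Bool) :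
    batchSequence T Δ f g c ∈ batchFamily T Δ f g := by
  -- The value beyond `T` is never read, since `t / Δ ≤ t < T`.
  refine ⟨fun n => if h : n < T then c ⟨n, h⟩ else false, fun t => ?_⟩
  simp [batchSequence, (Nat.div_le_self (t : ℕ) Δ).trans_lt t.isLt]

lemma integrable_cone_act (hbdd : Bornology.IsBounded Ω) (η : ℝ) (a : EuclideanSpace ℝ (Fin d))
    (π : Policy Ω 𝕌) (t : ℕ) (ν : Measure ((Fin t → EuclideanSpace ℝ (Fin d)) × 𝕌))
    [IsFiniteMeasure ν] : Integrable (fun x => cone η a (π.act t x.1 x.2)) ν := by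
  obtain ⟨R, hR⟩ := hbdd.exists_norm_le
  refine Integrable.of_bound
    ((measurable_cone η a).comp (π.measurable_act t)).aestronglyMeasurable (|η| * (R + ‖a‖))
    (.of_forall fun x => ?_)
  rw [cone, norm_mul, Real.norm_eq_abs, norm_norm]
  gcongr
  exact (norm_sub_le _ _).trans (by gcongr; exact hR _ (π.act_mem t x.1 x.2))

/-- With `η` so small that a batch reveals little, some batched sequence of cones forces an average
regret of `η * dist a b / 4` per round. -/
lemma exists_le_dynamicRegret (hbdd : Bornology.IsBounded Ω) {a b : EuclideanSpace ℝ (Fin d)}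
    (ha : a ∈ Ω) (hb : b ∈ Ω) (hab : a ≠ b) {K η : ℝ} (hK : 0 ≤ K) (hη : 0 < η) {T Δ : ℕ}
    (hΔ : 0 < Δ) (hsmall : Δ * (K * (2 * η) ^ 2) ≤ 1 / 8) {μ : Measure S} [IsProbabilityMeasure μ]
    {U : S → 𝕌} {ε : ℕ → S → EuclideanSpace ℝ (Fin d)} {lam : ℝ} (hU : Measurable U)
    (hε : IsNoise μ ε lam K) (hUε : IndepFun U (fun s t => ε t s) μ) (π : Policy Ω 𝕌)
    {G : ℕ → (EuclideanSpace ℝ (Fin d) → ℝ) → EuclideanSpace ℝ (Fin d) → EuclideanSpace ℝ (Fin d)}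
    (hG : IsSubgradientOracle Ω G) :
    ∃ F ∈ batchFamily T Δ (cone η a) (cone η b),
      T * (η * dist a b / 4) ≤ dynamicRegret μ U ε π G F := by
  set F : (Fin T → Bool) → Fin T → EuclideanSpace ℝ (Fin d) → ℝ :=
    batchSequence T Δ (cone η a) (cone η b) with hF
  have hFcase : ∀ c t, ∃ p ∈ Ω, F c t = cone η p := by
    intro c t
    simp only [hF, batchSequence]
    split_ifs
    exacts [⟨a, ha, rfl⟩, ⟨b, hb, rfl⟩]
  have hconv : ∀ c t, ConvexOn ℝ Set.univ (F c t) := by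
    intro c t
    obtain ⟨p, -, hp⟩ := hFcase c t
    rw [hp]
    exact convexOn_cone hη.le p
  have hGm : ∀ c, ∀ t : Fin T, Measurable (G t (F c t)) := fun c t => (hG t _ (hconv c t)).1
  have hGn : ∀ c, ∀ t : Fin T, ∀ w ∈ Ω, ‖G t (F c t) w‖ ≤ η := by
    intro c t w hw
    have h := (hG t _ (hconv c t)).2 w hw
    obtain ⟨p, -, hp⟩ := hFcase c t
    rw [hp] at h ⊢
    exact norm_le_of_mem_subdifferential_cone hη.le h
  have hH : ∀ c (t : Fin T), Measurable (history U ε π G (F c) t t.isLt.le) := fun c t =>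
    measurable_history hU hε.measurable π (hGm c) t t.isLt.le
  set j : Fin T → Fin T := fun t => ⟨t / Δ, (Nat.div_le_self _ _).trans_lt t.isLt⟩ with hj
  set L : Fin T → (Fin T → Bool) → ℝ := fun t c =>
    ∫ x, F c t (π.act t x.1 x.2) ∂(μ.map (history U ε π G (F c) t t.isLt.le)) with hL
  have hint : ∀ c (t : Fin T) (ν : Measure ((Fin (t : ℕ) → EuclideanSpace ℝ (Fin d)) × 𝕌))
      [IsFiniteMeasure ν], Integrable (fun x => F c t (π.act t x.1 x.2)) ν := by
    intro c t ν _
    obtain ⟨p, -, hp⟩ := hFcase c t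
    rw [hp]
    exact integrable_cone_act hbdd η p π t ν
  have hmeas : ∀ c t, Measurable (F c t) := by
    intro c t
    obtain ⟨p, -, hp⟩ := hFcase c t
    rw [hp]
    exact measurable_cone η p
  have hnn : ∀ c t x, 0 ≤ F c t x := by
    intro c t x
    obtain ⟨p, -, hp⟩ := hFcase c t
    rw [hp]
    exact cone_nonneg hη.le p x
  have hδ : 0 < η * dist a b := mul_pos hη (dist_pos.mpr hab)
  have hkey : ∀ t c, 2 * (η * dist a b / 4) ≤ L t c + L t (flipBit (j t) c) := by
    intro t c
    have := Measure.isProbabilityMeasure_map (μ := μ) (hH c t).aemeasurable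
    have := Measure.isProbabilityMeasure_map (μ := μ) (hH (flipBit (j t) c) t).aemeasurable
    have hkl : klDiv (μ.map (history U ε π G (F c) t t.isLt.le))
        (μ.map (history U ε π G (F (flipBit (j t) c)) t t.isLt.le)) ≤ ENNReal.ofReal (1 / 8) := by
      -- Flipping the bit used in round `t` changes only the losses of its own batch, which has at
      -- most `Δ` rounds.
      set D : Finset ℕ := (Finset.range T).filter (fun τ => τ / Δ = t / Δ) with hD
      have hDs : D ⊆ Finset.Ico (t / Δ * Δ) (t / Δ * Δ + Δ) := by
        intro τ hτ
        have hτ' := (Finset.mem_filter.mp hτ).2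
        rw [Finset.mem_Ico, ← hτ']
        have h1 := Nat.div_add_mod τ Δ
        have h2 := Nat.mod_lt τ hΔ
        rw [mul_comm] at h1
        omega
      have hDc : (D.filter (· < (t : ℕ))).card ≤ Δ := by
        refine (Finset.card_le_card ((Finset.filter_subset _ _).trans hDs)).trans ?_
        simp
      refine (klDiv_history_le hU hK hε hUε π (hGm c) (hGm _) D ?_
        (r := 2 * η) ?_ t t.isLt.le).trans ?_
      · intro τ hτ
        have hne : (⟨τ / Δ, (Nat.div_le_self _ _).trans_lt τ.isLt⟩ : Fin T) ≠ j t := by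
          intro heq
          exact hτ (Finset.mem_filter.mpr ⟨Finset.mem_range.mpr τ.isLt, congrArg Fin.val heq⟩)
        simp only [hF, batchSequence, flipBit, Function.update_of_ne hne]
      · intro τ w hw
        exact (norm_sub_le _ _).trans (by linarith [hGn c τ w hw, hGn (flipBit (j t) c) τ w hw])
      · calc ((D.filter (· < (t : ℕ))).card : ℝ≥0∞) * ENNReal.ofReal (K * (2 * η) ^ 2)
            ≤ (Δ : ℝ≥0∞) * ENNReal.ofReal (K * (2 * η) ^ 2) := by gcongr
          _ = ENNReal.ofReal (Δ * (K * (2 * η) ^ 2)) := by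
            rw [ENNReal.ofReal_mul (Nat.cast_nonneg _), ENNReal.ofReal_natCast]
          _ ≤ _ := ENNReal.ofReal_le_ofReal hsmall
    have hsum : ∀ x, η * dist a b ≤ F c t x + F (flipBit (j t) c) t x := by
      intro x
      have hx := mul_dist_le_cone_add_cone hη.le a b x
      have e1 : F c t = if c (j t) then cone η a else cone η b := rfl
      have e2 : F (flipBit (j t) c) t = if !c (j t) then cone η a else cone η b := by
        simp [hF, batchSequence, flipBit, hj]
      rw [e1, e2]
      cases c (j t) <;> simp <;> linarith
    have := half_le_integral_add_integral_of_klDiv_le hkl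
      ((hmeas c t).comp (π.measurable_act t)) (hint c t _) (hint (flipBit (j t) c) t _)
      (fun _ => hnn _ _ _) (fun _ => hnn _ _ _) hδ (fun _ => hsum _)
    simp only [hL]
    simp only [Function.comp_apply] at this
    linarith
  obtain ⟨c, hc⟩ := exists_le_sum_of_le_add_flipBit j L hkey
  refine ⟨F c, batchSequence_mem T Δ _ _ c, ?_⟩
  rw [Fintype.card_fin] at hc
  refine hc.trans (le_of_eq ?_)
  have hLt : ∀ t, L t c = ∫ s, F c t (decision π G (F c) (fun τ => ε τ s) (U s) t) ∂μ := fun t =>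
    integral_map (hH c t).aemeasurable
      ((hmeas c t).comp (π.measurable_act t)).aestronglyMeasurable
  have hinf : ∀ t, sInf (F c t '' Ω) = 0 := by
    intro t
    obtain ⟨p, hpΩ, hp⟩ := hFcase c t
    rw [hp]
    exact sInf_cone_image hη.le hpΩ
  rw [dynamicRegret, integral_finsetSum]
  · simp only [hLt, hinf, Finset.sum_const_zero, sub_zero]
  · intro t _
    have := Measure.isProbabilityMeasure_map (μ := μ) (hH c t).aemeasurable
    exact (hint c t (μ.map (history U ε π G (F c) t t.isLt.le))).comp_measurable (hH c t)

end Regret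

/-! ### Choice of the parameters and the rate. -/

lemma rpow_mul_rpow_le_sqrt_mul_sqrt {B T κ : ℝ} (hB : 0 < B) (hBT : B ≤ T) (hκ : 1 / 2 ≤ κ) :
    B ^ κ * T ^ (1 - κ) ≤ √B * √T := by
  have hT : 0 < T := hB.trans_le hBT
  have e1 : B ^ κ = √B * B ^ (κ - 1 / 2) := by
    rw [Real.sqrt_eq_rpow, ← Real.rpow_add hB]
    congr 1
    ring
  have e2 : √T = T ^ (κ - 1 / 2) * T ^ (1 - κ) := by
    rw [Real.sqrt_eq_rpow, ← Real.rpow_add hT]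
    congr 1
    ring
  rw [e1, e2, mul_assoc]
  gcongr

/-- Distance at most 1 lets the number of switches alone bound the path variation; convexity allows
moving one point towards the other. -/
lemma exists_dist_le_one_of_convex_nontrivial {d : ℕ} {Ω : Set (EuclideanSpace ℝ (Fin d))}
    (hΩ : Convex ℝ Ω) (hnt : Ω.Nontrivial) : ∃ a ∈ Ω, ∃ b ∈ Ω, a ≠ b ∧ dist a b ≤ 1 := by
  obtain ⟨a, ha, b, hb, hab⟩ := hnt
  have hd : 0 < ‖b - a‖ := norm_pos_iff.mpr (sub_ne_zero.mpr hab.symm)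
  set s : ℝ := min 1 (1 / ‖b - a‖) with hs
  have hs0 : 0 < s := lt_min one_pos (by positivity)
  have hs1 : s ≤ 1 := min_le_left _ _
  refine ⟨a, ha, a + s • (b - a), hΩ.add_smul_sub_mem ha hb ⟨hs0.le, hs1⟩, ?_, ?_⟩
  · intro h
    have h0 : s • (b - a) = 0 := by simpa using h.symm
    rcases smul_eq_zero.mp h0 with h1 | h1
    · exact hs0.ne' h1
    · exact hab (sub_eq_zero.mp h1).symm
  · rw [dist_self_add_right, norm_smul, Real.norm_eq_abs, abs_of_pos hs0]
    have : s ≤ 1 / ‖b - a‖ := min_le_right _ _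
    rwa [le_div_iff₀ hd] at this

theorem mainTheorem1 {d : ℕ} (Ω : Set (EuclideanSpace ℝ (Fin d)))
    (hΩ : Convex ℝ Ω) (hbdd : Bornology.IsBounded Ω) (hnt : Ω.Nontrivial)
    (K : ℝ) (hK : 0 < K) (κ : ℝ) (hκ : 1 / 2 < κ) (hκ' : κ < 1) :
    ∃ C : ℝ, 0 < C ∧ ∀ (T : ℕ) (B : ℝ), 1 ≤ B → B ≤ T →
      ∃ V' : Set (Fin T → EuclideanSpace ℝ (Fin d) → ℝ),
        V' ⊆ pathVariationClass Ω T B ∧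
        (∃ (f g : EuclideanSpace ℝ (Fin d) → ℝ) (Δ : ℕ), 1 ≤ Δ ∧ Δ ≤ T ∧
          (∀ m : ℝ, 0 < m → ¬ StrongConvexOn Ω m f ∧ ¬ StrongConvexOn Ω m g) ∧
          V' = batchFamily T Δ f g) ∧
        ∀ (S : Type*) [MeasurableSpace S] (μ : Measure S) [IsProbabilityMeasure μ]
          (𝕌 : Type*) [MeasurableSpace 𝕌] (U : S → 𝕌)
          (ε : ℕ → S → EuclideanSpace ℝ (Fin d)) (lam : ℝ),
          Measurable U → IsNoise μ ε lam K → IndepFun U (fun s t => ε t s) μ →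
          ∀ (π : Policy Ω 𝕌)
            (G : ℕ → (EuclideanSpace ℝ (Fin d) → ℝ) → EuclideanSpace ℝ (Fin d) →
              EuclideanSpace ℝ (Fin d)),
            IsSubgradientOracle Ω G →
            ((C * B ^ κ * (T : ℝ) ^ (1 - κ) : ℝ) : EReal) ≤ worstRegret μ U ε π G V' := by
  obtain ⟨a, ha, b, hb, hab, hab1⟩ := exists_dist_le_one_of_convex_nontrivial hΩ hnt
  have hδ : 0 < dist a b := dist_pos.mpr hab
  -- Here `32 = 8 * 4`: the 8 comes from `η ≥ √B / (8 * √K * √T)`, the 4 from the regret per round.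
  refine ⟨dist a b / (32 * √K), by positivity, fun T B hB hBT => ?_⟩
  have hB0 : 0 < B := one_pos.trans_le hB
  have hT0 : (0 : ℝ) < T := hB0.trans_le hBT
  set Δ : ℕ := ⌈(T : ℝ) / B⌉₊ with hΔdef
  have hΔpos : 0 < Δ := Nat.ceil_pos.mpr (by positivity)
  have hΔ0 : (0 : ℝ) < Δ := by exact_mod_cast hΔpos
  have hΔge : (T : ℝ) / B ≤ Δ := Nat.le_ceil _
  -- Rounding up costs at most a factor 2 because `B ≤ T`.
  have hΔle : (Δ : ℝ) ≤ 2 * (T / B) := by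
    have h1 := Nat.ceil_lt_add_one (a := (T : ℝ) / B) (by positivity)
    have h2 : 1 ≤ (T : ℝ) / B := (one_le_div hB0).mpr hBT
    linarith
  have hΔT : Δ ≤ T := Nat.ceil_le.mpr (div_le_self hT0.le hB)
  -- Chosen so that the divergence budget `Δ * K * (2η)²` equals 1/8 exactly.
  set η : ℝ := 1 / √(32 * K * Δ) with hηdef
  have hη : 0 < η := by positivity
  have hηsq : η ^ 2 = 1 / (32 * K * Δ) := by
    rw [hηdef, div_pow, Real.sq_sqrt (by positivity), one_pow]
  have hsmall : Δ * (K * (2 * η) ^ 2) ≤ 1 / 8 := by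
    rw [mul_pow, hηsq]
    apply le_of_eq
    field_simp
    norm_num
  have hbatches : ((T - 1) / Δ : ℕ) * dist a b ≤ B := by
    have h1 : (((T - 1) / Δ : ℕ) : ℝ) ≤ B := by
      calc (((T - 1) / Δ : ℕ) : ℝ) ≤ ((T / Δ : ℕ) : ℝ) := by
            exact_mod_cast Nat.div_le_div_right (Nat.sub_le T 1)
        _ ≤ (T : ℝ) / Δ := Nat.cast_div_le
        _ ≤ B := by
            rw [div_le_iff₀ hB0] at hΔge
            rw [div_le_iff₀ hΔ0]
            linarith
    calc _ ≤ B * 1 := by gcongr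
      _ = B := mul_one B
  have hrate : dist a b / (32 * √K) * B ^ κ * (T : ℝ) ^ (1 - κ) ≤ T * (η * dist a b / 4) := by
    have hηge : √B / (8 * √K * √T) ≤ η := by
      have h1 : √(32 * K * Δ) ≤ 8 * √K * √T / √B := by
        have e : 8 * √K * √T / √B = √(64 * K * T / B) := by
          rw [Real.sqrt_div (by positivity), Real.sqrt_mul (by positivity),
            Real.sqrt_mul (by positivity), show (64 : ℝ) = 8 ^ 2 by norm_num,
            Real.sqrt_sq (by norm_num)]
        rw [e]
        apply Real.sqrt_le_sqrt
        calc 32 * K * (Δ : ℝ) ≤ 32 * K * (2 * (T / B)) := by gcongr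
          _ = 64 * K * T / B := by ring
      calc √B / (8 * √K * √T) = 1 / (8 * √K * √T / √B) := by rw [one_div_div]
        _ ≤ η := one_div_le_one_div_of_le (by positivity) h1
    calc dist a b / (32 * √K) * B ^ κ * (T : ℝ) ^ (1 - κ)
        = dist a b / (32 * √K) * (B ^ κ * (T : ℝ) ^ (1 - κ)) := by ring
      _ ≤ dist a b / (32 * √K) * (√B * √T) := by
          exact mul_le_mul_of_nonneg_left (rpow_mul_rpow_le_sqrt_mul_sqrt hB0 hBT hκ.le)
            (by positivity)
      _ = T * (√B / (8 * √K * √T) * dist a b / 4) := by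
          have hTs : (T : ℝ) = √T * √T := (Real.mul_self_sqrt hT0.le).symm
          have hTpos : 0 < √(T : ℝ) := Real.sqrt_pos.mpr hT0
          nth_rewrite 2 [hTs]
          field_simp
          norm_num
      _ ≤ T * (η * dist a b / 4) := by gcongr
  refine ⟨batchFamily T Δ (cone η a) (cone η b),
    batchFamily_subset_pathVariationClass hη ha hb hbatches,
    ⟨_, _, Δ, hΔpos, hΔT, fun m hm => ⟨not_strongConvexOn_cone η ha hb hab hm,
      not_strongConvexOn_cone η hb ha hab.symm hm⟩, rfl⟩, ?_⟩
  intro S _ μ _ 𝕌 _ U ε lam hU hε hUε π G hG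
  obtain ⟨F, hF, hreg⟩ := exists_le_dynamicRegret (T := T) hbdd ha hb hab hK.le hη hΔpos hsmall
    hU hε hUε π hG
  refine (EReal.coe_le_coe_iff.mpr (hrate.trans hreg)).trans ?_
  exact le_iSup₂ (f := fun F (_ : F ∈ batchFamily T Δ (cone η a) (cone η b)) =>
    (dynamicRegret μ U ε π G F : EReal)) F hF
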